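/- Let $\mathbb D$ be the open unit disk in $\mathbb C$, let $\|\lambda\|=\max\{|\lambda^1|,|\lambda^2|\}$ for $\lambda=(\lambda^1,\lambda^2)\in\mathbb C^2$, so that $\mathbb D^2=\{\lambda\in\mathbb C^2:\|\lambda\|<1\}$, and let $\partial(\mathbb D^2)$ be the topological boundary of $\mathbb D^2$. Let $\varphi$ be in the Schur class of the bidisk, that is, $\varphi$ is holomorphic on $\mathbb D^2$ and $|\varphi|\le 1$ there. Let $\tau\in\partial(\mathbb D^2)$ be a $B$-point of $\varphi$, that is, $$\liminf_{\mathbb D^2\ni\lambda\to\tau}\frac{1-|\varphi(\lambda)|}{1-\|\lambda\|}<\infty .$$ Then the nontangential limit $\varphi(\tau)$ of $\varphi$ at $\tau$ exists, meaning that for every $c>0$, $\varphi(\lambda)\to\varphi(\tau)$ as $\lambda\to\tau$ within $\{\lambda\in\mathbb D^2:\|\tau-\lambda\|\le c(1-\|\lambda\|)\}$. Moreover the directional derivative $$D_{-\tau}\varphi(\tau)=\lim_{t\to0+}\frac{\varphi(\tau-t\tau)-\varphi(\tau)}{t}$$ exists, and $$D_{-\tau}\varphi(\tau)=-\varphi(\tau)\,\liminf_{\mathbb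 D^2\ni\lambda\to\tau}\frac{1-|\varphi(\lambda)|}{1-\|\lambda\|}.$$ -/

import Mathlib

open Filter Topology

noncomputable section

/-- The open bidisk `𝔻²` in `ℂ²`. The norm of `ℂ × ℂ` is the maximum norm, so `𝔻²` is
its open unit ball. -/
def bidisk : Set (ℂ × ℂ) := Metric.ball 0 1 ×ˢ Metric.ball 0 1

/-- The Schur class of the bidisk: holomorphic functions on `𝔻²` bounded by one in modulus.
Values of `φ` outside `𝔻²` are irrelevant and never used. -/
def SchurClass : Set (ℂ × ℂ → ℂ) :=
  {φ | DifferentiableOn ℂ φ bidisk ∧ ∀ z ∈ bidisk, ‖φ z‖ ≤ 1}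

/-- The lower limit of `(1 - |φ(z)|) / (1 - ‖z‖)` as `z` tends to `τ` in `𝔻²`,
as an extended real number. -/
def caratheodoryLiminf (φ : ℂ × ℂ → ℂ) (τ : ℂ × ℂ) : EReal :=
  liminf (fun z : ℂ × ℂ => (((1 - ‖φ z‖) / (1 - ‖z‖) : ℝ) : EReal)) (𝓝[bidisk] τ)

/-- `τ ∈ ∂(𝔻²)` is a `B`-point of `φ` if the lower limit above is finite. -/
def IsBPoint (φ : ℂ × ℂ → ℂ) (τ : ℂ × ℂ) : Prop :=
  τ ∈ frontier bidisk ∧ caratheodoryLiminf φ τ < ⊤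

/-- The nontangential approach region in `𝔻²` with vertex `τ` and aperture `c`. -/
def approachRegion (τ : ℂ × ℂ) (c : ℝ) : Set (ℂ × ℂ) :=
  {z | z ∈ bidisk ∧ ‖τ - z‖ ≤ c * (1 - ‖z‖)}

/-- The filter of nontangential convergence to `τ`: a function tends to a limit along it exactly
when it does so along every approach region with vertex `τ`. -/
def nontangential (τ : ℂ × ℂ) : Filter (ℂ × ℂ) :=
  ⨆ c : ℝ, 𝓝[approachRegion τ c] τ

/-- The value `φ(τ)` at a boundary point: the nontangential limit of `φ` at `τ`
(of significance only where that limit exists). -/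
def boundaryValue (φ : ℂ × ℂ → ℂ) (τ : ℂ × ℂ) : ℂ :=
  limUnder (nontangential τ) φ

/-- The one-sided directional derivative `D_δ φ(τ)` at a boundary point `τ` exists and
equals `L`: the limit of `(φ(τ + tδ) - φ(τ)) / t` as `t → 0+`, where `τ + tδ ∈ 𝔻²` for all
small `t > 0`. -/
def HasBoundaryDirDeriv (φ : ℂ × ℂ → ℂ) (τ δ : ℂ × ℂ) (L : ℂ) : Prop :=
  (∀ᶠ t : ℝ in 𝓝[>] 0, τ + t • δ ∈ bidisk) ∧
    Tendsto (fun t : ℝ => (φ (τ + t • δ) - boundaryValue φ τ) / (t : ℂ)) (𝓝[>] 0) (𝓝 L)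

end

open ComplexConjugate Set

/-! The Schwarz lemma for the max norm yields a Schwarz–Pick inequality on the bidisk that holds in
at least one of the two coordinates (`pickBound_of_mem_schurClass`). Let `w` tend to `τ` along an
ultrafilter that realizes the lower limit `α` and along which `φ w` converges, to `ω` say; then `‖ω‖
= 1`. In the limit Schwarz–Pick becomes Julia's inequality with constant `α`, again in one
coordinate depending on `z` (`exists_juliaBound`).

In approach regions this forces `φ → ω`. On the ray it bounds the modulus of the difference quotient
by a quantity tending to `α`, while the definition of `α` bounds the real part of the rotated
quotient from below. The two bounds squeeze the quotient (`tendsto_of_norm_le_of_le_re`). -/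

/-! ### Automorphisms of the disk -/

/-- The disk automorphism sending `0` to `w`. -/
noncomputable def diskShift (w z : ℂ) : ℂ := (z + w) / (1 + conj w * z)

lemma normSq_one_add_sub_normSq_add (w z : ℂ) :
    ‖1 + conj w * z‖ ^ 2 - ‖z + w‖ ^ 2 = (1 - ‖w‖ ^ 2) * (1 - ‖z‖ ^ 2) := by
  simp only [← Complex.normSq_eq_norm_sq, Complex.normSq_apply, Complex.add_re, Complex.add_im,
    Complex.mul_re, Complex.mul_im, Complex.conj_re, Complex.conj_im, Complex.one_re,
    Complex.one_im]
  ring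

lemma one_add_conj_mul_ne_zero {w z : ℂ} (hw : ‖w‖ < 1) (hz : ‖z‖ < 1) :
    1 + conj w * z ≠ 0 := by
  intro h
  have h1 : ‖conj w * z‖ = 1 := by
    rw [eq_neg_of_add_eq_zero_right h]; simp
  rw [norm_mul, RCLike.norm_conj] at h1
  nlinarith [norm_nonneg w, norm_nonneg z]

lemma one_sub_normSq_diskShift {w z : ℂ} (hw : ‖w‖ < 1) (hz : ‖z‖ < 1) :
    1 - ‖diskShift w z‖ ^ 2 = (1 - ‖w‖ ^ 2) * (1 - ‖z‖ ^ 2) / ‖1 + conj w * z‖ ^ 2 := by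
  have h := norm_ne_zero_iff.2 (one_add_conj_mul_ne_zero hw hz)
  rw [← normSq_one_add_sub_normSq_add, diskShift, norm_div, div_pow, sub_div,
    div_self (pow_ne_zero 2 h)]

lemma one_sub_norm_sq_pos {z : ℂ} (hz : ‖z‖ < 1) : 0 < 1 - ‖z‖ ^ 2 := by
  nlinarith [norm_nonneg z]

lemma norm_diskShift_lt_one {w z : ℂ} (hw : ‖w‖ < 1) (hz : ‖z‖ < 1) :
    ‖diskShift w z‖ < 1 := by
  have h : 0 < 1 - ‖diskShift w z‖ ^ 2 := by
    rw [one_sub_normSq_diskShift hw hz]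
    have := one_sub_norm_sq_pos hw
    have := one_sub_norm_sq_pos hz
    have := norm_pos_iff.2 (one_add_conj_mul_ne_zero hw hz)
    positivity
  nlinarith [norm_nonneg (diskShift w z)]

@[simp] lemma diskShift_zero (w : ℂ) : diskShift w 0 = w := by simp [diskShift]

@[simp] lemma diskShift_neg_self (w : ℂ) : diskShift (-w) w = 0 := by simp [diskShift]

lemma diskShift_diskShift_neg {w z : ℂ} (hw : ‖w‖ < 1) (hz : ‖z‖ < 1) :
    diskShift w (diskShift (-w) z) = z := by
  have h1 := one_add_conj_mul_ne_zero (w := -w) (by simpa using hw) hz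
  have h2 := one_add_conj_mul_ne_zero hw
    (norm_diskShift_lt_one (w := -w) (by simpa using hw) hz)
  unfold diskShift at h2 ⊢
  rw [div_eq_iff h2]
  have h3 := div_mul_cancel₀ (z + -w) h1
  rw [map_neg] at h3 ⊢
  linear_combination h3

lemma differentiableOn_diskShift {w : ℂ} (hw : ‖w‖ < 1) :
    DifferentiableOn ℂ (diskShift w) (Metric.ball 0 1) := by
  intro z hz
  have := one_add_conj_mul_ne_zero hw (mem_ball_zero_iff.1 hz)
  unfold diskShift
  fun_prop (disch := assumption)

/-! ### Schwarz–Pick on the bidisk -/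

lemma bidisk_eq_ball : bidisk = Metric.ball 0 1 := by
  rw [bidisk, ball_prod_same]; rfl

lemma mem_bidisk {z : ℂ × ℂ} : z ∈ bidisk ↔ ‖z‖ < 1 := by
  rw [bidisk_eq_ball, mem_ball_zero_iff]

/-- One coordinate inequality of the Schwarz–Pick lemma, with denominators cleared. -/
def PickBound (a b z w : ℂ) : Prop :=
  ‖1 - conj b * a‖ ^ 2 * ((1 - ‖w‖ ^ 2) * (1 - ‖z‖ ^ 2)) ≤
    (1 - ‖b‖ ^ 2) * (1 - ‖a‖ ^ 2) * ‖1 - conj w * z‖ ^ 2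

lemma pickBound_of_norm_diskShift_le {a b z w : ℂ} (ha : ‖a‖ < 1) (hb : ‖b‖ < 1) (hz : ‖z‖ < 1)
    (hw : ‖w‖ < 1) (h : ‖diskShift (-b) a‖ ≤ ‖diskShift (-w) z‖) : PickBound a b z w := by
  have hb' : ‖-b‖ < 1 := by simpa using hb
  have hw' : ‖-w‖ < 1 := by simpa using hw
  have h1 := norm_pos_iff.2 (one_add_conj_mul_ne_zero hb' ha)
  have h2 := norm_pos_iff.2 (one_add_conj_mul_ne_zero hw' hz)
  have h3 : 1 - ‖diskShift (-w) z‖ ^ 2 ≤ 1 - ‖diskShift (-b) a‖ ^ 2 := by gcongr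
  rw [one_sub_normSq_diskShift hw' hz, one_sub_normSq_diskShift hb' ha,
    div_le_div_iff₀ (by positivity) (by positivity)] at h3
  simp only [map_neg, neg_mul, ← sub_eq_add_neg, norm_neg] at h3
  unfold PickBound
  linarith

/-- Automorphisms of the bidisk and of the disk move `w` and `φ w` to the origin. The Schwarz lemma
then bounds by a max norm, which one coordinate attains; hence the disjunction. -/
lemma pickBound_of_norm_lt {φ : ℂ × ℂ → ℂ} (hd : DifferentiableOn ℂ φ bidisk)
    (hφ : ∀ z ∈ bidisk, ‖φ z‖ < 1) {z w : ℂ × ℂ} (hz : z ∈ bidisk) (hw : w ∈ bidisk) :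
    PickBound (φ z) (φ w) z.1 w.1 ∨ PickBound (φ z) (φ w) z.2 w.2 := by
  have hz' := hz
  have hw' := hw
  simp only [bidisk, mem_prod, mem_ball_zero_iff] at hz' hw'
  obtain ⟨hz1, hz2⟩ := hz'
  obtain ⟨hw1, hw2⟩ := hw'
  have hb : ‖-φ w‖ < 1 := by simpa using hφ w hw
  let m : ℂ × ℂ → ℂ × ℂ := fun u => (diskShift w.1 u.1, diskShift w.2 u.2)
  have hm : MapsTo m bidisk bidisk := by
    rintro ⟨u, v⟩ h
    simp only [bidisk, mem_prod, mem_ball_zero_iff] at h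
    simp only [bidisk, mem_prod, mem_ball_zero_iff, m]
    exact ⟨norm_diskShift_lt_one hw1 h.1, norm_diskShift_lt_one hw2 h.2⟩
  have hmd : DifferentiableOn ℂ m bidisk :=
    ((differentiableOn_diskShift hw1).comp differentiableOn_fst fun u hu => hu.1).prodMk
      ((differentiableOn_diskShift hw2).comp differentiableOn_snd fun u hu => hu.2)
  let h : ℂ × ℂ → ℂ := fun u => diskShift (-φ w) (φ (m u))
  have hh : DifferentiableOn ℂ h (Metric.ball 0 1) := by
    rw [← bidisk_eq_ball]
    exact (differentiableOn_diskShift hb).comp (hd.comp hmd hm)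
      fun u hu => mem_ball_zero_iff.2 (hφ _ (hm hu))
  have hmaps : MapsTo h (Metric.ball 0 1) (Metric.closedBall 0 1) := by
    rw [← bidisk_eq_ball]
    exact fun u hu => mem_closedBall_zero_iff.2 (norm_diskShift_lt_one hb (hφ _ (hm hu))).le
  have h0 : h 0 = 0 := by simp [h, m]
  let u : ℂ × ℂ := (diskShift (-w.1) z.1, diskShift (-w.2) z.2)
  have hu1 : ‖u.1‖ < 1 := norm_diskShift_lt_one (by simpa using hw1) hz1
  have hu2 : ‖u.2‖ < 1 := norm_diskShift_lt_one (by simpa using hw2) hz2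
  have key := Complex.norm_le_norm_of_mapsTo_ball hh hmaps h0 (z := u) (max_lt hu1 hu2)
  have hmu : m u = z := by
    simp only [m, u, diskShift_diskShift_neg hw1 hz1, diskShift_diskShift_neg hw2 hz2]
  simp only [h, hmu] at key
  rcases le_max_iff.1 key with k | k
  · exact .inl (pickBound_of_norm_diskShift_le (hφ z hz) (hφ w hw) hz1 hw1 k)
  · exact .inr (pickBound_of_norm_diskShift_le (hφ z hz) (hφ w hw) hz2 hw2 k)

/-- The **Schwarz–Pick lemma** for the bidisk. -/
lemma pickBound_of_mem_schurClass {φ : ℂ × ℂ → ℂ} (hφ : φ ∈ SchurClass) {z w : ℂ × ℂ}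
    (hz : z ∈ bidisk) (hw : w ∈ bidisk) :
    PickBound (φ z) (φ w) z.1 w.1 ∨ PickBound (φ z) (φ w) z.2 w.2 := by
  -- Each alternative is closed in the scaling factor `r`, so the strict case, applied to `r * φ`
  -- with `r < 1`, passes to `r = 1`.
  have hcl (x y : ℂ) : IsClosed {r : ℝ | PickBound (r * φ z) (r * φ w) x y} := by
    unfold PickBound
    exact isClosed_le (by fun_prop) (by fun_prop)
  have ht : Tendsto (fun r : ℝ => r) (𝓝[<] 1) (𝓝 1) := tendsto_nhdsWithin_of_tendsto_nhds tendsto_id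
  have := ((hcl z.1 w.1).union (hcl z.2 w.2)).mem_of_tendsto ht (by
    filter_upwards [Ioo_mem_nhdsLT (zero_lt_one' ℝ)] with r hr
    refine pickBound_of_norm_lt (φ := fun u => r * φ u) (hφ.1.const_mul _) (fun u hu => ?_) hz hw
    rw [norm_mul, Complex.norm_real, Real.norm_of_nonneg hr.1.le]
    nlinarith [hφ.2 u hu, hr.1, hr.2, norm_nonneg (φ u)])
  simpa using this

/-! ### Julia's inequality -/

/-- An ultrafilter along which the Carathéodory quotient tends to its (finite) lower limit. -/
lemma exists_ultrafilter_tendsto_liminf {α : Type*} {F : Filter α} {q : α → ℝ} {a : ℝ}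
    (h : liminf (fun x => (q x : EReal)) F = a) :
    ∃ U : Ultrafilter α, ↑U ≤ F ∧ Tendsto q U (𝓝 a) := by
  refine mapClusterPt_iff_ultrafilter.1 (mapClusterPt_iff_frequently.2 fun s hs => ?_)
  obtain ⟨l, u, hlu, hs⟩ := mem_nhds_iff_exists_Ioo_subset.1 hs
  have h1 : ∀ᶠ x in F, (l : EReal) < q x :=
    eventually_lt_of_lt_liminf (by rw [h]; exact_mod_cast hlu.1)
  have h2 : ∃ᶠ x in F, (q x : EReal) < u :=
    frequently_lt_of_liminf_lt (by isBoundedDefault) (by rw [h]; exact_mod_cast hlu.2)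
  exact (h2.and_eventually h1).mono fun x hx =>
    hs ⟨by exact_mod_cast hx.2, by exact_mod_cast hx.1⟩

lemma norm_one_sub_conj_mul {ω : ℂ} (hω : ‖ω‖ = 1) (a : ℂ) : ‖1 - conj ω * a‖ = ‖ω - a‖ := by
  have h : conj ω * ω = 1 := by rw [Complex.conj_mul', hω]; simp
  rw [show 1 - conj ω * a = conj ω * (ω - a) by rw [mul_sub, h], norm_mul, RCLike.norm_conj, hω,
    one_mul]

/-- One coordinate of Julia's inequality, available where the boundary point is unimodular. -/
def JuliaBound (α : ℝ) (ω a t z : ℂ) : Prop :=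
  ‖t‖ = 1 ∧ ‖ω - a‖ ^ 2 * (1 - ‖z‖ ^ 2) ≤ α * (1 - ‖a‖ ^ 2) * ‖t - z‖ ^ 2

/-- Passage to the limit in one coordinate of the Schwarz–Pick inequality. -/
lemma juliaBound_or_eq {ι : Type*} {U : Filter ι} [U.NeBot] {f p : ι → ℂ} {s : ι → ℝ}
    {a ω t z : ℂ} {α : ℝ} (hz : ‖z‖ < 1) (ht : ‖t‖ ≤ 1) (hω : ‖ω‖ = 1)
    (hf : Tendsto f U (𝓝 ω)) (hp : Tendsto p U (𝓝 t))
    (hq : Tendsto (fun i => (1 - ‖f i‖) / s i) U (𝓝 α))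
    (hs : ∀ᶠ i in U, 0 < s i ∧ s i ≤ 1 - ‖p i‖)
    (hP : ∀ᶠ i in U, PickBound a (f i) z (p i)) :
    JuliaBound α ω a t z ∨ ω = a := by
  have hz' := one_sub_norm_sq_pos hz
  have hc : Continuous (conj : ℂ → ℂ) := Complex.continuous_conj
  have hL : Tendsto (fun i => ‖1 - conj (f i) * a‖ ^ 2) U (𝓝 (‖ω - a‖ ^ 2)) := by
    rw [← norm_one_sub_conj_mul hω]
    exact ((tendsto_const_nhds.sub (((hc.tendsto _).comp hf).mul_const a)).norm).pow 2
  have hR : Tendsto (fun i => ‖1 - conj (p i) * z‖ ^ 2) U (𝓝 (‖1 - conj t * z‖ ^ 2)) :=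
    ((tendsto_const_nhds.sub (((hc.tendsto _).comp hp).mul_const z)).norm).pow 2
  rcases ht.lt_or_eq with ht | ht
  -- The coordinate of the boundary point is interior: the right side tends to `0` because `‖f i‖ →
  -- 1`, while the factor multiplying `‖ω - a‖ ^ 2` keeps a positive limit.
  · right
    have h1 := le_of_tendsto_of_tendsto
      (hL.mul (((hp.norm.pow 2).const_sub 1).mul_const (1 - ‖z‖ ^ 2)))
      ((((hf.norm.pow 2).const_sub 1).mul_const (1 - ‖a‖ ^ 2)).mul hR) hP
    rw [hω] at h1
    have h2 := mul_pos (one_sub_norm_sq_pos ht) hz'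
    have h3 : ‖ω - a‖ ^ 2 ≤ 0 := by
      by_contra! h
      nlinarith [mul_pos h h2]
    exact sub_eq_zero.1 (norm_eq_zero.1 (pow_eq_zero_iff two_ne_zero |>.1
      (h3.antisymm (sq_nonneg _))))
  · left
    refine ⟨ht, ?_⟩
    rw [norm_one_sub_conj_mul ht] at hR
    -- Factor `1 - x ^ 2 = (1 - x) * (1 + x)` and divide by `s i`; the factors `1 + ‖p i‖` and `1 +
    -- ‖f i‖` both tend to `2` and cancel.
    have h1 := le_of_tendsto_of_tendsto
      (hL.mul ((hp.norm.const_add 1).mul_const (1 - ‖z‖ ^ 2)))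
      (((hq.mul (hf.norm.const_add 1)).mul_const (1 - ‖a‖ ^ 2)).mul hR) (by
        filter_upwards [hs, hP] with i hi hPi
        have hs0 := hi.1
        refine le_of_mul_le_mul_left ?_ hs0
        unfold PickBound at hPi
        have e : s i * ((1 - ‖f i‖) / s i * (1 + ‖f i‖) * (1 - ‖a‖ ^ 2) *
            ‖1 - conj (p i) * z‖ ^ 2) =
            (1 - ‖f i‖ ^ 2) * (1 - ‖a‖ ^ 2) * ‖1 - conj (p i) * z‖ ^ 2 := by
          field_simp
          ring
        refine le_trans ?_ (hPi.trans_eq e.symm)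
        have h4 : s i * (1 + ‖p i‖) ≤ 1 - ‖p i‖ ^ 2 := by nlinarith [hi.2, norm_nonneg (p i)]
        calc _ = ‖1 - conj (f i) * a‖ ^ 2 * (s i * (1 + ‖p i‖) * (1 - ‖z‖ ^ 2)) := by ring
          _ ≤ _ := by gcongr)
    rw [ht, hω] at h1
    linarith

/-- Both sides vanish, so the degenerate case `ω = φ z` is absorbed by whichever coordinate of `τ`
is unimodular. -/
lemma juliaBound_of_unimodular {ω a t z : ℂ} {α : ℝ} (hω : ‖ω‖ = 1) (ht : ‖t‖ = 1) (h : ω = a) :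
    JuliaBound α ω a t z := by
  subst h
  simp [JuliaBound, ht, hω]

lemma norm_fst_or_snd_eq_one {τ : ℂ × ℂ} (hτ : ‖τ‖ = 1) : ‖τ.1‖ = 1 ∨ ‖τ.2‖ = 1 := by
  rcases max_choice ‖τ.1‖ ‖τ.2‖ with h | h
  · exact .inl (h.symm.trans hτ)
  · exact .inr (h.symm.trans hτ)

/-- **Julia's inequality** for the bidisk. -/
lemma exists_juliaBound {φ : ℂ × ℂ → ℂ} (hφ : φ ∈ SchurClass) {τ : ℂ × ℂ} (hτ : ‖τ‖ = 1) {α : ℝ}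
    (h : caratheodoryLiminf φ τ = α) :
    ∃ ω : ℂ, ‖ω‖ = 1 ∧ ∀ z ∈ bidisk,
      JuliaBound α ω (φ z) τ.1 z.1 ∨ JuliaBound α ω (φ z) τ.2 z.2 := by
  obtain ⟨U, hU, hq⟩ := exists_ultrafilter_tendsto_liminf h
  have hUτ : Tendsto id (U : Filter (ℂ × ℂ)) (𝓝 τ) := hU.trans nhdsWithin_le_nhds
  have hUb : ∀ᶠ w in (U : Filter (ℂ × ℂ)), w ∈ bidisk := hU self_mem_nhdsWithin
  obtain ⟨ω, -, hω⟩ := (isCompact_closedBall (0 : ℂ) 1).ultrafilter_le_nhds (U.map φ) (by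
    simp only [Ultrafilter.coe_map, le_principal_iff, mem_map]
    filter_upwards [hUb] with w hw
    simpa using hφ.2 w hw)
  replace hω : Tendsto φ U (𝓝 ω) := hω
  have hω1 : ‖ω‖ = 1 := by
    have h1 : Tendsto (fun w : ℂ × ℂ => 1 - ‖w‖) U (𝓝 0) := by
      have := hUτ.norm.const_sub 1
      rwa [hτ, sub_self] at this
    have h2 : Tendsto (fun w => 1 - ‖φ w‖) U (𝓝 0) := by
      refine (mul_zero α ▸ hq.mul h1).congr' ?_
      filter_upwards [hUb] with w hw
      exact div_mul_cancel₀ _ (sub_pos.2 (mem_bidisk.1 hw)).ne'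
    have := tendsto_nhds_unique h2 (hω.norm.const_sub 1)
    linarith
  refine ⟨ω, hω1, fun z hz => ?_⟩
  have hz' := max_lt_iff.1 (mem_bidisk.1 hz)
  have hτ' := max_le_iff.1 hτ.le
  have key : (JuliaBound α ω (φ z) τ.1 z.1 ∨ ω = φ z) ∨
      (JuliaBound α ω (φ z) τ.2 z.2 ∨ ω = φ z) := by
    -- An ultrafilter decides the disjunction: one coordinate serves for almost all `w`. It may vary
    -- with `z`, but `ω` does not.
    rcases Ultrafilter.eventually_or.1
      (hUb.mono fun w hw => pickBound_of_mem_schurClass hφ hz hw) with hP | hP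
    · refine .inl (juliaBound_or_eq hz'.1 hτ'.1 hω1 hω
        ((continuous_fst.tendsto τ).comp hUτ) hq ?_ hP)
      filter_upwards [hUb] with w hw
      exact ⟨sub_pos.2 (mem_bidisk.1 hw), sub_le_sub_left (norm_fst_le w) 1⟩
    · refine .inr (juliaBound_or_eq hz'.2 hτ'.2 hω1 hω
        ((continuous_snd.tendsto τ).comp hUτ) hq ?_ hP)
      filter_upwards [hUb] with w hw
      exact ⟨sub_pos.2 (mem_bidisk.1 hw), sub_le_sub_left (norm_snd_le w) 1⟩
  have heq : ω = φ z → JuliaBound α ω (φ z) τ.1 z.1 ∨ JuliaBound α ω (φ z) τ.2 z.2 := fun e =>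
    (norm_fst_or_snd_eq_one hτ).imp (juliaBound_of_unimodular hω1 · e)
      (juliaBound_of_unimodular hω1 · e)
  tauto

/-! ### Nontangential limit and radial derivative -/

/-- Julia's inequality inside an approach region. -/
lemma JuliaBound.norm_sub_sq_le {ω a t z : ℂ} {α c d r : ℝ} (h : JuliaBound α ω a t z)
    (hα : 0 ≤ α) (hd : 0 < d) (hz : d ≤ 1 - ‖z‖) (hr : ‖t - z‖ ≤ r) (hc : r ≤ c * d) :
    ‖ω - a‖ ^ 2 ≤ α * c * r := by
  have h1 : d ≤ 1 - ‖z‖ ^ 2 := by nlinarith [norm_nonneg z]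
  refine le_of_mul_le_mul_right ?_ hd
  have hr0 := (norm_nonneg _).trans hr
  calc ‖ω - a‖ ^ 2 * d ≤ ‖ω - a‖ ^ 2 * (1 - ‖z‖ ^ 2) := by gcongr
    _ ≤ α * (1 - ‖a‖ ^ 2) * ‖t - z‖ ^ 2 := h.2
    _ ≤ α * 1 * (r * (c * d)) := by
      have : ‖t - z‖ ^ 2 ≤ r * (c * d) := by
        rw [sq]; gcongr; exact hr.trans hc
      have : 1 - ‖a‖ ^ 2 ≤ 1 := by nlinarith [norm_nonneg a]
      gcongr
    _ = α * c * r * d := by ring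

/-- Julia's inequality on the ray towards the boundary point. -/
lemma JuliaBound.norm_sub_le {ω a t z : ℂ} {α x : ℝ} (h : JuliaBound α ω a t z)
    (hω : ‖ω‖ = 1) (ha : ‖a‖ ≤ 1) (hα : 0 ≤ α) (hx : 0 < x) (hx1 : x < 1) (hz : z = t - x * t) :
    ‖ω - a‖ ≤ 2 * α * x / (2 - x) := by
  have e1 : ‖t - z‖ = x := by
    rw [hz, sub_sub_cancel, norm_mul, h.1, Complex.norm_real, Real.norm_of_nonneg hx.le, mul_one]
  have e2 : ‖z‖ = 1 - x := by
    rw [hz, show t - x * t = ((1 - x : ℝ) : ℂ) * t by push_cast; ring, norm_mul, h.1,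
      Complex.norm_real, Real.norm_of_nonneg (by linarith), mul_one]
  have h2 := h.2
  rw [e1, e2] at h2
  -- This makes the right side of Julia's inequality linear in `‖ω - a‖`, so one factor cancels from
  -- the square on the left.
  have h3 : 1 - ‖a‖ ≤ ‖ω - a‖ := hω ▸ norm_sub_norm_le ω a
  have h4 : 1 - ‖a‖ ^ 2 ≤ 2 * ‖ω - a‖ := by nlinarith [norm_nonneg a]
  rw [le_div_iff₀ (by linarith)]
  rcases (norm_nonneg (ω - a)).eq_or_lt with h0 | h0
  · rw [← h0]; nlinarith
  refine le_of_mul_le_mul_left ?_ (mul_pos hx h0)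
  calc x * ‖ω - a‖ * (‖ω - a‖ * (2 - x)) = ‖ω - a‖ ^ 2 * (1 - (1 - x) ^ 2) := by ring
    _ ≤ _ := h2
    _ ≤ α * (2 * ‖ω - a‖) * x ^ 2 := by gcongr
    _ = _ := by ring

/-- If the real part of `u` is eventually above every `b < α` and `‖u‖` is bounded by a function
tending to `α`, then `u` tends to `α`. -/
lemma tendsto_of_norm_le_of_le_re {ι : Type*} {F : Filter ι} {u : ι → ℂ} {l v : ι → ℝ} {α : ℝ}
    (hl : ∀ᶠ i in F, l i ≤ (u i).re) (hv : ∀ᶠ i in F, ‖u i‖ ≤ v i)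
    (hlα : ∀ b < α, ∀ᶠ i in F, b < l i) (hvα : Tendsto v F (𝓝 α)) :
    Tendsto u F (𝓝 α) := by
  have hre : Tendsto (fun i => (u i).re) F (𝓝 α) := by
    refine tendsto_order.2 ⟨fun b hb => ?_, fun b hb => ?_⟩
    · filter_upwards [hl, hlα b hb] with i h1 h2 using h2.trans_le h1
    · filter_upwards [hv, hvα.eventually_lt_const hb] with i h1 h2
      exact ((Complex.re_le_norm _).trans h1).trans_lt h2
  rw [tendsto_iff_norm_sub_tendsto_zero]
  -- The radicand comes from `‖u - α‖ ^ 2 = ‖u‖ ^ 2 - 2 * α * u.re + α ^ 2`.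
  have h0 : Tendsto (fun i => √(v i ^ 2 - 2 * α * (u i).re + α ^ 2)) F (𝓝 0) := by
    have := ((hvα.pow 2).sub (hre.const_mul (2 * α))).add_const (α ^ 2)
    rw [show α ^ 2 - 2 * α * α + α ^ 2 = 0 by ring] at this
    simpa using this.sqrt
  refine tendsto_of_tendsto_of_tendsto_of_le_of_le' tendsto_const_nhds h0
    (.of_forall fun i => norm_nonneg _) ?_
  filter_upwards [hv] with i hi
  refine Real.le_sqrt_of_sq_le ?_
  have h1 : ‖u i‖ ^ 2 ≤ v i ^ 2 := by gcongr
  simp only [← Complex.normSq_eq_norm_sq, Complex.normSq_apply, Complex.sub_re, Complex.sub_im,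
    Complex.ofReal_re, Complex.ofReal_im] at h1 ⊢
  nlinarith

lemma norm_eq_one_of_mem_frontier_bidisk {τ : ℂ × ℂ} (hτ : τ ∈ frontier bidisk) : ‖τ‖ = 1 := by
  rw [bidisk_eq_ball, frontier_ball 0 one_ne_zero] at hτ
  simpa using hτ

lemma norm_one_sub_smul {τ : ℂ × ℂ} (hτ : ‖τ‖ = 1) {t : ℝ} (ht : t ∈ Ioo 0 1) :
    ‖τ + t • -τ‖ = 1 - t := by
  rw [show τ + t • -τ = (1 - t) • τ by module, norm_smul, hτ, mul_one,
    Real.norm_of_nonneg (by linarith [ht.2])]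

lemma tendsto_ray (τ : ℂ × ℂ) : Tendsto (fun t : ℝ => τ + t • -τ) (𝓝[>] 0) (𝓝 τ) := by
  have h : Continuous fun t : ℝ => τ + t • -τ := by fun_prop
  simpa using (h.tendsto 0).mono_left nhdsWithin_le_nhds

lemma tendsto_ray_nhdsWithin {τ : ℂ × ℂ} (hτ : ‖τ‖ = 1) :
    Tendsto (fun t : ℝ => τ + t • -τ) (𝓝[>] 0) (𝓝[bidisk] τ) := by
  refine tendsto_nhdsWithin_iff.2 ⟨tendsto_ray τ, ?_⟩
  filter_upwards [Ioo_mem_nhdsGT (zero_lt_one' ℝ)] with t ht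
  rw [mem_bidisk, norm_one_sub_smul hτ ht]
  linarith [ht.1]

/-- Needed for `limUnder` to identify the limit; the ray already lies in the region of aperture `1`.
-/
lemma nontangential_neBot {τ : ℂ × ℂ} (hτ : ‖τ‖ = 1) : (nontangential τ).NeBot := by
  have h : (𝓝[approachRegion τ 1] τ).NeBot := by
    refine (tendsto_nhdsWithin_iff.2 ⟨tendsto_ray τ, ?_⟩).neBot
    filter_upwards [Ioo_mem_nhdsGT (zero_lt_one' ℝ)] with t ht
    refine ⟨?_, ?_⟩
    · rw [mem_bidisk, norm_one_sub_smul hτ ht]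
      linarith [ht.1]
    · rw [norm_one_sub_smul hτ ht, show τ - (τ + t • -τ) = t • τ by module, norm_smul, hτ,
        Real.norm_of_nonneg ht.1.le]
      linarith
  exact h.mono (le_iSup (fun c => 𝓝[approachRegion τ c] τ) 1)

lemma tendsto_nontangential_of_juliaBound {φ : ℂ × ℂ → ℂ} {τ : ℂ × ℂ} {ω : ℂ} {α : ℝ}
    (hα : 0 ≤ α) (hJ : ∀ z ∈ bidisk,
      JuliaBound α ω (φ z) τ.1 z.1 ∨ JuliaBound α ω (φ z) τ.2 z.2) :
    Tendsto φ (nontangential τ) (𝓝 ω) := by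
  refine tendsto_iSup.2 fun c => ?_
  rw [tendsto_iff_norm_sub_tendsto_zero]
  have h0 : Tendsto (fun z : ℂ × ℂ => √(α * c * ‖τ - z‖)) (𝓝[approachRegion τ c] τ) (𝓝 0) := by
    have h : Continuous fun z : ℂ × ℂ => √(α * c * ‖τ - z‖) := by fun_prop
    simpa using (h.tendsto τ).mono_left nhdsWithin_le_nhds
  refine tendsto_of_tendsto_of_tendsto_of_le_of_le' tendsto_const_nhds h0
    (.of_forall fun i => norm_nonneg _) ?_
  filter_upwards [self_mem_nhdsWithin] with z hz
  obtain ⟨hz, hc⟩ := hz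
  have hd := sub_pos.2 (mem_bidisk.1 hz)
  rw [norm_sub_rev]
  refine Real.le_sqrt_of_sq_le ?_
  rcases hJ z hz with h | h
  · exact h.norm_sub_sq_le hα hd (sub_le_sub_left (norm_fst_le z) 1) (norm_fst_le (τ - z)) hc
  · exact h.norm_sub_sq_le hα hd (sub_le_sub_left (norm_snd_le z) 1) (norm_snd_le (τ - z)) hc

lemma tendsto_ray_of_juliaBound {φ : ℂ × ℂ → ℂ} (hφ : φ ∈ SchurClass) {τ : ℂ × ℂ} (hτ : ‖τ‖ = 1)
    {ω : ℂ} (hω : ‖ω‖ = 1) {α : ℝ} (hα : 0 ≤ α) (h : caratheodoryLiminf φ τ = α)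
    (hJ : ∀ z ∈ bidisk, JuliaBound α ω (φ z) τ.1 z.1 ∨ JuliaBound α ω (φ z) τ.2 z.2) :
    Tendsto (fun t : ℝ => (φ (τ + t • -τ) - ω) / (t : ℂ)) (𝓝[>] 0) (𝓝 (-ω * α)) := by
  have hωω : ω * conj ω = 1 := by rw [Complex.mul_conj', hω]; simp
  have hev : ∀ᶠ t : ℝ in 𝓝[>] 0, t ∈ Ioo (0 : ℝ) 1 := Ioo_mem_nhdsGT (zero_lt_one' ℝ)
  have hb := (tendsto_ray_nhdsWithin hτ).eventually self_mem_nhdsWithin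
  -- Multiplying by `conj ω` makes the expected limit the real number `α`.
  have key : Tendsto (fun t : ℝ => conj ω * (ω - φ (τ + t • -τ)) / (t : ℂ)) (𝓝[>] 0) (𝓝 (α : ℂ)) := by
    refine tendsto_of_norm_le_of_le_re (l := fun t : ℝ => (1 - ‖φ (τ + t • -τ)‖) / t)
      (v := fun t => 2 * α / (2 - t)) ?_ ?_ ?_ ?_
    · filter_upwards [hev] with t ht
      rw [Complex.div_ofReal_re, mul_sub, mul_comm _ ω, hωω, Complex.sub_re, Complex.one_re]
      have := Complex.re_le_norm (conj ω * φ (τ + t • -τ))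
      rw [norm_mul, RCLike.norm_conj, hω, one_mul] at this
      have := ht.1
      gcongr
    · filter_upwards [hev, hb] with t ht htb
      rw [norm_div, norm_mul, RCLike.norm_conj, hω, one_mul, Complex.norm_real,
        Real.norm_of_nonneg ht.1.le, div_le_iff₀ ht.1, div_mul_eq_mul_div]
      rcases hJ _ htb with h | h
      · exact h.norm_sub_le hω (hφ.2 _ htb) hα ht.1 ht.2 (by simp; ring)
      · exact h.norm_sub_le hω (hφ.2 _ htb) hα ht.1 ht.2 (by simp; ring)
    · intro b hbα
      have h1 : ∀ᶠ z in 𝓝[bidisk] τ, (b : EReal) < (((1 - ‖φ z‖) / (1 - ‖z‖) : ℝ) : EReal) :=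
        eventually_lt_of_lt_liminf (by
          change (b : EReal) < caratheodoryLiminf φ τ
          rw [h]; exact_mod_cast hbα)
      filter_upwards [hev, (tendsto_ray_nhdsWithin hτ).eventually h1] with t ht h2
      rwa [EReal.coe_lt_coe_iff, norm_one_sub_smul hτ ht, sub_sub_cancel] at h2
    · have h1 : Tendsto (fun t : ℝ => 2 * α / (2 - t)) (𝓝 0) (𝓝 (2 * α / (2 - 0))) :=
        tendsto_const_nhds.div (tendsto_id.const_sub 2) (by norm_num)
      rw [show 2 * α / (2 - 0) = α by ring] at h1
      exact h1.mono_left nhdsWithin_le_nhds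
  refine (key.const_mul (-ω)).congr fun t => ?_
  linear_combination (φ (τ + t • -τ) - ω) / (t : ℂ) * hωω

lemma exists_caratheodoryLiminf_eq {φ : ℂ × ℂ → ℂ} (hφ : φ ∈ SchurClass) {τ : ℂ × ℂ}
    (h : caratheodoryLiminf φ τ < ⊤) : ∃ α : ℝ, 0 ≤ α ∧ caratheodoryLiminf φ τ = α := by
  have h0 : 0 ≤ caratheodoryLiminf φ τ := by
    refine le_liminf_of_le (by isBoundedDefault) ?_
    filter_upwards [self_mem_nhdsWithin] with z hz
    exact_mod_cast div_nonneg (sub_nonneg.2 (hφ.2 z hz)) (sub_pos.2 (mem_bidisk.1 hz)).le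
  have e := EReal.coe_toReal h.ne (ne_bot_of_le_ne_bot (by simp) h0)
  exact ⟨_, EReal.toReal_nonneg h0, e.symm⟩

theorem mainTheorem5 (φ : ℂ × ℂ → ℂ) (hφ : φ ∈ SchurClass) (τ : ℂ × ℂ)
    (hτ : IsBPoint φ τ) :
    Tendsto φ (nontangential τ) (𝓝 (boundaryValue φ τ)) ∧
      ∃ α : ℝ, caratheodoryLiminf φ τ = (α : EReal) ∧
        HasBoundaryDirDeriv φ τ (-τ) (-(boundaryValue φ τ) * (α : ℂ)) := by
  have hτ1 := norm_eq_one_of_mem_frontier_bidisk hτ.1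
  obtain ⟨α, hα, h⟩ := exists_caratheodoryLiminf_eq hφ hτ.2
  obtain ⟨ω, hω, hJ⟩ := exists_juliaBound hφ hτ1 h
  have ht := tendsto_nontangential_of_juliaBound hα hJ
  have := nontangential_neBot hτ1
  have hbv : boundaryValue φ τ = ω := ht.limUnder_eq
  simp only [HasBoundaryDirDeriv, hbv]
  exact ⟨ht, α, h, (tendsto_ray_nhdsWithin hτ1).eventually self_mem_nhdsWithin,
    tendsto_ray_of_juliaBound hφ hτ1 hω hα h hJ⟩
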